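/- Let $q$ be a prime power, $\Lambda=\mathbb F_q[T]$ and $F=\mathbb F_q((T^{-1}))$, with the absolute value $|0|=0$, $|f|=q^{\deg f}$ for $f\neq 0$. Equip each $F^m$ with the supremum norm $\|\cdot\|$ and with the Haar measure $\lambda$ that gives the closed unit ball measure $1$. Let $n\ge 2$ and $\mathbf a=(\alpha_0,\dots,\alpha_{n-1})\in F^n$, and write $\tilde{\mathbf x}=(1,\mathbf x)$ for $\mathbf x\in F^{n-1}$. Assume that for some $\delta>0$ all but finitely many $q'\in\Lambda$ satisfy $$\max_{0\le i\le n-1}|p_i+\alpha_i q'|>\frac1{|q'|^{\,n-\delta}}\qquad\text{for all }\mathbf p=(p_0,\dots,p_{n-1})\in\Lambda^n .$$ Then for every open ball $U\subseteq F^{n-1}$ there exist constants $K_0,K_1>0$, depending only on $q$, $n$, $U$ and $\mathbf a$, with the following property. Let $\psi:\{q^r: r\in\mathbb Z_{\ge0}\}\to\{q^s: s\in\mathbb Z\}$ be any nonincreasing function with $$\Sigma_\psi:=\sum_{\mathbf q\in\Lambda^n\setminus\{\mathbf 0\}}\psi(\|\mathbf q\|)<\infty\qquad\text{and}\qquad \psi(q^r)\le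 q^{-rn}\ \text{ for all integers } r\ge 0 .$$ Then for every $\xi\in(0,1)$ and every real $$\kappa<\min\left\{1,\ \frac{\xi}{2q\,\Sigma_\psi},\ \left(\frac{\xi}{2K_0K_1}\right)^{n^2-1}\right\},$$ the set of all $\mathbf x\in U$ such that $$|(\mathbf x,\tilde{\mathbf x}\cdot\mathbf a)\cdot\mathbf q+p|\ \ge\ \kappa\,\psi(\|\mathbf q\|)\qquad\text{for all }\mathbf q\in\Lambda^n\setminus\{\mathbf 0\}\text{ and all }p\in\Lambda$$ has $\lambda$-measure at least $(1-\xi)\lambda(U)$. -/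

import Mathlib

open MeasureTheory Polynomial Topology
open scoped LaurentSeries

namespace FunctionFieldApprox

/-! The field `F = 𝔽_q((T⁻¹))` is Mathlib's field of Laurent series `𝔽⸨X⸩` over the finite field
`𝔽`, the variable `X` of the series playing the role of `T⁻¹`. Its topology is the valuation
topology provided by Mathlib. -/

/-- The degree of a nonzero element of `F`: the largest exponent of `T` that occurs in it, that is,
minus the smallest exponent of `X = T⁻¹`. -/
noncomputable def deg {𝔽 : Type*} [Field 𝔽] (f : 𝔽⸨X⸩) : ℤ := -f.order

open Classical in
/-- The absolute value on `F`: `|0| = 0` and `|f| = q ^ deg f` for `f ≠ 0`, `q` being the number of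
elements of `𝔽`. -/
noncomputable def absVal {𝔽 : Type*} [Field 𝔽] (f : 𝔽⸨X⸩) : ℝ :=
  if f = 0 then 0 else (Nat.card 𝔽 : ℝ) ^ deg f

/-- The element `T = X⁻¹` of `F`. -/
noncomputable def elemT (𝔽 : Type*) [Field 𝔽] : 𝔽⸨X⸩ := HahnSeries.single (-1 : ℤ) (1 : 𝔽)

/-- The inclusion of `Λ = 𝔽_q[T]` in `F`, sending the polynomial variable to `T`. -/
noncomputable def incl {𝔽 : Type*} [Field 𝔽] : 𝔽[X] →+* 𝔽⸨X⸩ :=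
  Polynomial.eval₂RingHom HahnSeries.C (elemT 𝔽)

/-- The coordinatewise inclusion of `Λ ^ ι` in `F ^ ι`. -/
noncomputable def inclVec {𝔽 ι : Type*} [Field 𝔽] (v : ι → 𝔽[X]) : ι → 𝔽⸨X⸩ :=
  fun i => incl (v i)

/-- The supremum norm on `F ^ ι`. -/
noncomputable def supNorm {𝔽 ι : Type*} [Field 𝔽] (x : ι → 𝔽⸨X⸩) : ℝ := ⨆ i, absVal (x i)

/-- The open ball of centre `c` and radius `r` for the supremum norm. -/
def openBall {𝔽 ι : Type*} [Field 𝔽] (c : ι → 𝔽⸨X⸩) (r : ℝ) : Set (ι → 𝔽⸨X⸩) :=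
  {x | supNorm (x - c) < r}

/-- The closed unit ball for the supremum norm. -/
def unitBall (𝔽 ι : Type*) [Field 𝔽] : Set (ι → 𝔽⸨X⸩) := {x | supNorm x ≤ 1}

/-! ### Normalized Haar measure -/

theorem absVal_le_one_iff {𝔽 : Type*} [Field 𝔽] [Finite 𝔽] (f : 𝔽⸨X⸩) :
    absVal f ≤ 1 ↔ Valued.v f ≤ (1 : WithZero (Multiplicative ℤ)) := by
  have hq : (1 : ℝ) < Nat.card 𝔽 := by exact_mod_cast Finite.one_lt_card
  have h1 : (1 : WithZero (Multiplicative ℤ)) = WithZero.exp (-(0 : ℤ)) := by simp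
  rw [h1, LaurentSeries.valuation_le_iff_coeff_lt_eq_zero]
  by_cases hf : f = 0
  · simp [absVal, hf]
  · rw [absVal, if_neg hf, zpow_le_one_iff_right₀ hq, deg]
    constructor
    · intro h n hn
      exact HahnSeries.coeff_eq_zero_of_lt_order (by omega)
    · intro h
      by_contra hc
      exact HahnSeries.coeff_order_eq_zero.not.mpr hf (h _ (by omega))

theorem mem_unitBall_iff {𝔽 ι : Type*} [Field 𝔽] [Finite 𝔽] [Finite ι] (x : ι → 𝔽⸨X⸩) :
    x ∈ unitBall 𝔽 ι ↔ ∀ i, Valued.v (x i) ≤ (1 : WithZero (Multiplicative ℤ)) := by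
  simp only [← absVal_le_one_iff]
  constructor
  · intro h i
    exact (le_ciSup (f := fun i => absVal (x i)) (Set.finite_range _).bddAbove i).trans h
  · intro h
    exact Real.iSup_le h zero_le_one

theorem nhds_hasBasis {𝔽 : Type*} [Field 𝔽] (x : 𝔽⸨X⸩) :
    (𝓝 x).HasBasis (fun _ : ℕ => True) (fun D => {y | ∀ n : ℤ, n < D → y.coeff n = x.coeff n}) := by
  have key : ∀ (D : ℕ) (y : 𝔽⸨X⸩), Valued.v (y - x) ≤ WithZero.exp (-(D : ℤ)) ↔
      ∀ n : ℤ, n < D → y.coeff n = x.coeff n := by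
    intro D y
    rw [LaurentSeries.valuation_le_iff_coeff_lt_eq_zero]
    simp only [HahnSeries.coeff_sub, sub_eq_zero]
  refine ⟨fun t => ?_⟩
  rw [Valued.mem_nhds]
  constructor
  · rintro ⟨γ, hγ⟩
    set g : WithZero (Multiplicative ℤ) :=
      MonoidWithZeroHom.ValueGroup₀.embedding γ.1 with hg
    have hg0 : g ≠ 0 := by simp [hg]
    refine ⟨(1 - WithZero.log g).toNat, trivial, fun y hy => hγ ?_⟩
    have h2 := (key _ y).mpr hy
    show Valued.v.restrict (y - x) < (γ : MonoidWithZeroHom.ValueGroup₀ _)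
    rw [Valued.v.restrict_lt_iff_lt_embedding]
    refine lt_of_le_of_lt h2 ?_
    rw [← hg, ← WithZero.lt_log_iff_exp_lt hg0]
    omega
  · rintro ⟨D, -, hD⟩
    have hne : Valued.v.restrict (HahnSeries.single (D : ℤ) (1 : 𝔽) : 𝔽⸨X⸩) ≠ 0 := by
      simp
    refine ⟨Units.mk0 _ hne, fun y hy => hD ?_⟩
    rw [Set.mem_ofPred_eq, ← key]
    have hy' : Valued.v.restrict (y - x) <
      Valued.v.restrict (HahnSeries.single (D : ℤ) (1 : 𝔽) : 𝔽⸨X⸩) := hy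
    rw [Valuation.restrict_lt_iff] at hy'
    rw [LaurentSeries.valuation_single_zpow] at hy'
    exact hy'.le

theorem isCompact_integers (𝔽 : Type*) [Field 𝔽] [Finite 𝔽] :
    IsCompact {f : 𝔽⸨X⸩ | Valued.v f ≤ (1 : WithZero (Multiplicative ℤ))} := by
  let : TopologicalSpace 𝔽 := ⊥
  have : DiscreteTopology 𝔽 := ⟨rfl⟩
  let φ : (ℕ → 𝔽) → 𝔽⸨X⸩ := fun c => ((PowerSeries.mk c : PowerSeries 𝔽) : 𝔽⸨X⸩)
  have hcoeff : ∀ (c : ℕ → 𝔽) (n : ℤ), (φ c).coeff n = if n < 0 then 0 else c n.natAbs := by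
    intro c n
    simp only [φ]
    rw [PowerSeries.coeff_coe]
    simp
  have hφ : Continuous φ := by
    rw [continuous_iff_continuousAt]
    intro c
    rw [ContinuousAt, (nhds_hasBasis (φ c)).tendsto_right_iff]
    intro D _
    have : ∀ᶠ c' in 𝓝 c, ∀ m ∈ Finset.range D, c' m = c m := by
      rw [Filter.eventually_all_finset]
      intro m _
      exact (continuous_apply m).continuousAt.eventually
        (show {c m} ∈ 𝓝 (c m) from (isOpen_discrete _).mem_nhds rfl)
    filter_upwards [this] with c' hc' n hn
    rw [hcoeff, hcoeff]
    split_ifs with h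
    · rfl
    · exact hc' _ (Finset.mem_range.mpr (by omega))
  have : {f : 𝔽⸨X⸩ | Valued.v f ≤ (1 : WithZero (Multiplicative ℤ))} = Set.range φ := by
    ext f
    rw [Set.mem_ofPred_eq, LaurentSeries.val_le_one_iff_eq_coe]
    constructor
    · rintro ⟨G, rfl⟩
      refine ⟨fun n => PowerSeries.coeff n G, ?_⟩
      simp only [φ]
      congr 1
      ext n
      simp
    · rintro ⟨c, rfl⟩
      exact ⟨_, rfl⟩
  rw [this]
  exact isCompact_range hφ

theorem isOpen_integers (𝔽 : Type*) [Field 𝔽] :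
    IsOpen {f : 𝔽⸨X⸩ | Valued.v f ≤ (1 : WithZero (Multiplicative ℤ))} := by
  have h1 : (1 : WithZero (Multiplicative ℤ)) = WithZero.exp (-(0 : ℤ)) := by simp
  simp only [h1, LaurentSeries.valuation_le_iff_coeff_lt_eq_zero]
  rw [isOpen_iff_mem_nhds]
  intro x hx
  refine Filter.mem_of_superset ((nhds_hasBasis x).mem_of_mem (i := 0) trivial) ?_
  intro y hy n hn
  rw [hy n (by simpa using hn)]
  exact hx n hn

instance instSecondCountable (𝔽 : Type*) [Field 𝔽] [Finite 𝔽] :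
    SecondCountableTopology 𝔽⸨X⸩ := by
  have : (𝓝 (0 : 𝔽⸨X⸩)).IsCountablyGenerated := (nhds_hasBasis 0).isCountablyGenerated
  have := IsUniformAddGroup.uniformity_countably_generated (α := 𝔽⸨X⸩)
  have : Countable 𝔽[X] := by
    rw [← Cardinal.mk_le_aleph0_iff]
    exact Polynomial.cardinalMk_le_max.trans (by simp)
  have : Countable (RatFunc 𝔽) := by
    refine Function.Surjective.countable (α := 𝔽[X] × 𝔽[X])
      (f := fun P => algebraMap 𝔽[X] (RatFunc 𝔽) P.1 / algebraMap 𝔽[X] (RatFunc 𝔽) P.2) ?_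
    intro f
    exact ⟨(f.num, f.denom), RatFunc.num_div_denom f⟩
  have : TopologicalSpace.SeparableSpace 𝔽⸨X⸩ :=
    ⟨⟨_, Set.countable_range _, LaurentSeries.coe_range_dense (K := 𝔽)⟩⟩
  exact UniformSpace.secondCountable_of_separable _

/-- `F` carries its Borel `σ`-algebra; the product `σ`-algebra on `F ^ ι` is then the Borel one. -/
noncomputable instance instMeasurableSpace (𝔽 : Type*) [Field 𝔽] : MeasurableSpace 𝔽⸨X⸩ := borel _

instance instBorelSpace (𝔽 : Type*) [Field 𝔽] : BorelSpace 𝔽⸨X⸩ := ⟨rfl⟩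

theorem unitBall_eq_pi (𝔽 ι : Type*) [Field 𝔽] [Finite 𝔽] [Finite ι] :
    unitBall 𝔽 ι = Set.univ.pi
      fun _ => {f : 𝔽⸨X⸩ | Valued.v f ≤ (1 : WithZero (Multiplicative ℤ))} := by
  ext x
  simp [mem_unitBall_iff]

/-- The closed unit ball of `F ^ ι`, as a compact set with nonempty interior. -/
noncomputable def unitBallCompacts (𝔽 ι : Type*) [Field 𝔽] [Finite 𝔽] [Finite ι] :
    TopologicalSpace.PositiveCompacts (ι → 𝔽⸨X⸩) where
  carrier := unitBall 𝔽 ι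
  isCompact' := by
    rw [unitBall_eq_pi]
    exact isCompact_univ_pi fun _ => isCompact_integers 𝔽
  interior_nonempty' := by
    have h : IsOpen (unitBall 𝔽 ι) := by
      rw [unitBall_eq_pi]
      exact isOpen_set_pi Set.finite_univ fun _ _ => isOpen_integers 𝔽
    rw [h.interior_eq]
    exact ⟨0, by simp [mem_unitBall_iff]⟩

/-- The Haar measure on `F ^ ι` that gives measure `1` to the closed unit ball. -/
noncomputable def haar (𝔽 ι : Type*) [Field 𝔽] [Finite 𝔽] [Finite ι] :
    Measure (ι → 𝔽⸨X⸩) :=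
  Measure.addHaarMeasure (unitBallCompacts 𝔽 ι)

/-! ### The hyperplane and the sets of the theorem

Here `n = d + 1`, so that `F ^ (n - 1)` is `Fin d → 𝔽⸨X⸩` and `F ^ n` is `Fin (d + 1) → 𝔽⸨X⸩`. -/

/-- The vector `x̃ = (1, x)`. -/
noncomputable def tilde {𝔽 : Type*} [Field 𝔽] {d : ℕ} (x : Fin d → 𝔽⸨X⸩) : Fin (d + 1) → 𝔽⸨X⸩ :=
  Fin.cons 1 x

/-- The point `(x, x̃ · a)` of the affine hyperplane defined by `a = (α₀, …, α_{n-1})`. -/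
noncomputable def hyperplanePoint {𝔽 : Type*} [Field 𝔽] {d : ℕ} (a : Fin (d + 1) → 𝔽⸨X⸩)
    (x : Fin d → 𝔽⸨X⸩) : Fin (d + 1) → 𝔽⸨X⸩ :=
  Fin.snoc x (tilde x ⬝ᵥ a)

/-- The Diophantine condition on `a`: for some `δ > 0`, all but finitely many `q' ∈ Λ` satisfy
`max_i |p_i + α_i q'| > 1 / |q'| ^ (n - δ)` for all `p ∈ Λ ^ n`, where `n = d + 1`. -/
def DiophantineCondition {𝔽 : Type*} [Field 𝔽] {d : ℕ} (a : Fin (d + 1) → 𝔽⸨X⸩) : Prop :=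
  ∃ δ : ℝ, 0 < δ ∧
    {q' : 𝔽[X] | ¬ ∀ p : Fin (d + 1) → 𝔽[X],
      1 / absVal (incl q') ^ (((d + 1 : ℕ) : ℝ) - δ) <
        supNorm (fun i => incl (p i) + a i * incl q')}.Finite

/-- `ψ` restricts to a nonincreasing function from `{q ^ r : r ≥ 0}` to `{q ^ s : s ∈ ℤ}`. The
values of `ψ` elsewhere are irrelevant. -/
def IsApproximationFunction (𝔽 : Type*) [Field 𝔽] (ψ : ℝ → ℝ) : Prop :=
  (∀ r : ℕ, ∃ s : ℤ, ψ ((Nat.card 𝔽 : ℝ) ^ r) = (Nat.card 𝔽 : ℝ) ^ s) ∧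
    ∀ r s : ℕ, r ≤ s → ψ ((Nat.card 𝔽 : ℝ) ^ s) ≤ ψ ((Nat.card 𝔽 : ℝ) ^ r)

/-- The terms `ψ(‖q‖)` of the series `Σ_ψ`, indexed by the nonzero `q ∈ Λ ^ n`. -/
noncomputable def psiTerm {𝔽 : Type*} [Field 𝔽] (n : ℕ) (ψ : ℝ → ℝ)
    (v : {v : Fin n → 𝔽[X] // v ≠ 0}) : ℝ :=
  ψ (supNorm (inclVec v.1))

/-- The set of all `x ∈ U` such that `|(x, x̃ · a) · q + p| ≥ κ ψ(‖q‖)` for all nonzero `q ∈ Λ ^ n`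
and all `p ∈ Λ`. -/
def goodSet {𝔽 : Type*} [Field 𝔽] {d : ℕ} (a : Fin (d + 1) → 𝔽⸨X⸩) (U : Set (Fin d → 𝔽⸨X⸩))
    (ψ : ℝ → ℝ) (κ : ℝ) : Set (Fin d → 𝔽⸨X⸩) :=
  {x | x ∈ U ∧ ∀ v : Fin (d + 1) → 𝔽[X], v ≠ 0 → ∀ p : 𝔽[X],
    κ * ψ (supNorm (inclVec v)) ≤ absVal (hyperplanePoint a x ⬝ᵥ inclVec v + incl p)}

end FunctionFieldApprox

/-!
For `v ∈ Λ ^ n` with last coordinate `u` and `p ∈ Λ`, the quantity `(x, x̃ · a) · v + p` is an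
affine form `e₀ + e₁ x₁ + ⋯ + e_d x_d` in `x`, whose coefficients `e₀ = p + α₀ u`,
`e_i = v_i + α_i u` form the vector that the Diophantine condition bounds from below. The ball `U`,
of radius `r`, is covered by the good set and the strips on which such a form is too small.
They fall into two kinds,
according to the size of the gradient `(e₁, …, e_d)`, which does not depend on `p`.

*Large gradient*, `r ‖(e₁, …, e_d)‖ ≥ 1`. The form is equidistributed modulo `Λ` on `U`, so the
points of `U` at which it is within `κ ψ(‖v‖)` of `Λ` have relative measure at most `q κ ψ(‖v‖)`
(`haar_near_incl_le`). Summing over `v` gives at most `q κ Σ_ψ ≤ ξ / 2`.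

*Small gradient.* No quantitative nondivergence is needed here: a direct count is enough. Using
`ψ(‖v‖) ≤ ‖v‖ ^ (-n) ≤ q ^ (-n deg u)`, the strip of a single form has relative measure
`O(κ / (q ^ (n deg u) ‖e‖))` (`haar_small_le`), and `‖e‖` is bounded. The sum of
`1 / (q ^ (n deg u) ‖e‖)` over all integral pairs with bounded `e` converges (`tsum_errVec_ne_top`):
by the Diophantine condition the vectors `e` with `deg u` bounded are separated, which limits how
many of them can be short (`encard_errVec_le`). So these strips have total relative measure `O(κ)`,
with a constant depending only on `q`, `n`, `U` and `a`. A suitable `K₁` makes this at most `ξ / 2`,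
since `κ < (ξ / (2 K₁)) ^ (n² - 1)` with `ξ / (2 K₁) ≤ 1` gives `κ ≤ ξ / (2 K₁)`.

Both measure bounds come from `haar_strip_le_zpow`: translates of a strip along a coordinate of
largest coefficient stay in the ultrametric ball and are pairwise disjoint.
-/

namespace FunctionFieldApprox

/-! ### The absolute value and the supremum norm -/

section AbsVal

variable {𝔽 : Type*} [Field 𝔽]

theorem absVal_zero : absVal (0 : 𝔽⸨X⸩) = 0 := by simp [absVal]

theorem absVal_of_ne_zero {f : 𝔽⸨X⸩} (hf : f ≠ 0) : absVal f = (Nat.card 𝔽 : ℝ) ^ deg f := by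
  simp [absVal, hf]

theorem absVal_nonneg (f : 𝔽⸨X⸩) : 0 ≤ absVal f := by
  unfold absVal
  split_ifs
  · rfl
  · positivity

theorem absVal_neg (f : 𝔽⸨X⸩) : absVal (-f) = absVal f := by
  by_cases hf : f = 0
  · simp [hf]
  · rw [absVal_of_ne_zero hf, absVal_of_ne_zero (neg_ne_zero.mpr hf), deg, deg,
      HahnSeries.order_neg]

theorem incl_monomial (n : ℕ) (b : 𝔽) :
    incl (monomial n b) = (HahnSeries.single (-(n : ℤ)) b : 𝔽⸨X⸩) := by
  simp [incl, elemT, HahnSeries.single_pow, HahnSeries.C_apply, HahnSeries.single_mul_single]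

theorem coeff_incl (p : 𝔽[X]) (m : ℕ) : (incl p).coeff (-(m : ℤ)) = p.coeff m := by
  induction p using Polynomial.induction_on' with
  | add p q hp hq => simp [hp, hq]
  | monomial n b =>
    rw [incl_monomial, HahnSeries.coeff_single, Polynomial.coeff_monomial]
    simp [eq_comm]

theorem incl_injective : Function.Injective (incl : 𝔽[X] → 𝔽⸨X⸩) := by
  intro p q h
  ext m
  rw [← coeff_incl, h, coeff_incl]

theorem incl_ne_zero {p : 𝔽[X]} (hp : p ≠ 0) : (incl p : 𝔽⸨X⸩) ≠ 0 :=
  (map_ne_zero_iff _ incl_injective).mpr hp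

theorem deg_incl (p : 𝔽[X]) : deg (incl p) = p.natDegree := by
  by_cases hp : p = 0
  · simp [hp, deg]
  have h0 := incl_ne_zero hp
  have hle : (incl p).order ≤ -(p.natDegree : ℤ) := by
    apply HahnSeries.order_le_of_coeff_ne_zero
    rw [coeff_incl]
    simpa using hp
  have hge : -(p.natDegree : ℤ) ≤ (incl p).order := by
    by_contra! hlt
    have h1 := HahnSeries.coeff_order_eq_zero.not.mpr h0
    obtain ⟨k, hk⟩ : ∃ k : ℕ, (incl p).order = -(k : ℤ) :=
      ⟨(incl p).order.natAbs, by omega⟩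
    rw [hk, coeff_incl] at h1
    have := Polynomial.le_natDegree_of_ne_zero h1
    omega
  unfold deg
  omega

theorem absVal_one : absVal (1 : 𝔽⸨X⸩) = 1 := by
  simp [absVal, deg]

theorem absVal_incl {p : 𝔽[X]} (hp : p ≠ 0) :
    absVal (incl p) = (Nat.card 𝔽 : ℝ) ^ p.natDegree := by
  rw [absVal_of_ne_zero (incl_ne_zero hp), deg_incl, zpow_natCast]

variable [Finite 𝔽]

theorem one_lt_card_real (𝔽 : Type*) [Field 𝔽] [Finite 𝔽] : (1 : ℝ) < Nat.card 𝔽 := by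
  exact_mod_cast Finite.one_lt_card

theorem card_real_pos (𝔽 : Type*) [Field 𝔽] [Finite 𝔽] : (0 : ℝ) < Nat.card 𝔽 :=
  one_pos.trans (one_lt_card_real 𝔽)

theorem absVal_pos {f : 𝔽⸨X⸩} (hf : f ≠ 0) : 0 < absVal f := by
  rw [absVal_of_ne_zero hf]
  exact zpow_pos (card_real_pos 𝔽) _

theorem absVal_eq_zero_iff {f : 𝔽⸨X⸩} : absVal f = 0 ↔ f = 0 :=
  ⟨fun h => by_contra fun hf => (absVal_pos hf).ne' h, fun h => h ▸ absVal_zero⟩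

theorem absVal_mul (f g : 𝔽⸨X⸩) : absVal (f * g) = absVal f * absVal g := by
  by_cases hf : f = 0
  · simp [hf, absVal_zero]
  by_cases hg : g = 0
  · simp [hg, absVal_zero]
  rw [absVal_of_ne_zero hf, absVal_of_ne_zero hg, absVal_of_ne_zero (mul_ne_zero hf hg),
    ← zpow_add₀ (card_real_pos 𝔽).ne', deg, HahnSeries.order_mul hf hg, deg, deg, neg_add]

/-- The absolute value as a homomorphism of monoids with zero. -/
noncomputable def absValHom (𝔽 : Type*) [Field 𝔽] [Finite 𝔽] : 𝔽⸨X⸩ →*₀ ℝ where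
  toFun := absVal
  map_zero' := absVal_zero
  map_one' := absVal_one
  map_mul' := absVal_mul

theorem absVal_div (f g : 𝔽⸨X⸩) : absVal (f / g) = absVal f / absVal g :=
  map_div₀ (absValHom 𝔽) f g

theorem absVal_add_le (f g : 𝔽⸨X⸩) : absVal (f + g) ≤ max (absVal f) (absVal g) := by
  by_cases hf : f = 0
  · simp [hf]
  by_cases hg : g = 0
  · simp [hg]
  by_cases hfg : f + g = 0
  · rw [hfg, absVal_zero]
    exact (absVal_nonneg f).trans (le_max_left _ _)
  rw [absVal_of_ne_zero hf, absVal_of_ne_zero hg, absVal_of_ne_zero hfg]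
  have h := HahnSeries.min_order_le_order_add hfg
  have hq := (one_lt_card_real 𝔽).le
  rcases min_le_iff.mp h with h | h
  · exact (zpow_le_zpow_right₀ hq (neg_le_neg h)).trans (le_max_left _ _)
  · exact (zpow_le_zpow_right₀ hq (neg_le_neg h)).trans (le_max_right _ _)

theorem absVal_sub_le (f g : 𝔽⸨X⸩) : absVal (f - g) ≤ max (absVal f) (absVal g) := by
  rw [sub_eq_add_neg, ← absVal_neg g]
  exact absVal_add_le f (-g)

theorem absVal_add_eq_of_lt {f g : 𝔽⸨X⸩} (h : absVal g < absVal f) :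
    absVal (f + g) = absVal f := by
  apply le_antisymm
  · exact (absVal_add_le f g).trans (max_le le_rfl h.le)
  · have h1 := absVal_sub_le (f + g) g
    rw [add_sub_cancel_right] at h1
    rcases le_max_iff.mp h1 with h2 | h2
    · exact h2
    · exact absurd h2 (not_le.mpr h)

theorem absVal_sum_le {ι : Type*} (s : Finset ι) (f : ι → 𝔽⸨X⸩) {B : ℝ} (hB : 0 ≤ B)
    (h : ∀ i ∈ s, absVal (f i) ≤ B) : absVal (∑ i ∈ s, f i) ≤ B := by
  classical
  induction s using Finset.induction_on with
  | empty => simpa [absVal_zero] using hB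
  | insert i s hi ih =>
    rw [Finset.sum_insert hi]
    exact (absVal_add_le _ _).trans (max_le (h i (by simp))
      (ih fun j hj => h j (Finset.mem_insert_of_mem hj)))

theorem absVal_elemT_zpow (k : ℤ) : absVal (elemT 𝔽 ^ k) = (Nat.card 𝔽 : ℝ) ^ k := by
  have h : absVal (elemT 𝔽) = Nat.card 𝔽 := by
    rw [elemT, absVal_of_ne_zero (by simp), deg, HahnSeries.order_single one_ne_zero, neg_neg,
      zpow_one]
  rw [← h]
  exact map_zpow₀ (absValHom 𝔽) (elemT 𝔽) k

theorem one_le_absVal_incl {p : 𝔽[X]} (hp : p ≠ 0) : 1 ≤ absVal (incl p) := by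
  rw [absVal_incl hp]
  exact one_le_pow₀ (one_lt_card_real 𝔽).le

theorem eq_zero_of_absVal_incl_lt_one {p : 𝔽[X]} (h : absVal (incl p) < 1) : p = 0 :=
  by_contra fun hp => not_lt.mpr (one_le_absVal_incl hp) h

theorem absVal_lt_iff_of_mem_Ioc {r : ℝ} {j : ℤ}
    (hj : r ∈ Set.Ioc ((Nat.card 𝔽 : ℝ) ^ j) ((Nat.card 𝔽 : ℝ) ^ (j + 1))) (f : 𝔽⸨X⸩) :
    absVal f < r ↔ absVal f < (Nat.card 𝔽 : ℝ) ^ (j + 1) := by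
  refine ⟨fun h => h.trans_le hj.2, fun h => ?_⟩
  by_cases hf : f = 0
  · rw [hf, absVal_zero]
    exact (zpow_pos (card_real_pos 𝔽) _).trans hj.1
  · rw [absVal_of_ne_zero hf, zpow_lt_zpow_iff_right₀ (one_lt_card_real 𝔽)] at h
    rw [absVal_of_ne_zero hf]
    exact (zpow_le_zpow_right₀ (one_lt_card_real 𝔽).le (Int.lt_add_one_iff.mp h)).trans_lt hj.1

theorem isOpen_absVal_lt (r : ℝ) : IsOpen {f : 𝔽⸨X⸩ | absVal f < r} := by
  rcases le_or_gt r 0 with hr | hr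
  · have : {f : 𝔽⸨X⸩ | absVal f < r} = ∅ :=
      Set.eq_empty_iff_forall_notMem.mpr fun f hf => not_lt.mpr (hr.trans (absVal_nonneg f)) hf
    rw [this]
    exact isOpen_empty
  obtain ⟨j, hj⟩ := exists_mem_Ioc_zpow hr (one_lt_card_real 𝔽)
  have hset : {f : 𝔽⸨X⸩ | absVal f < r} = (fun f => elemT 𝔽 ^ (-j) * f) ⁻¹'
      {f : 𝔽⸨X⸩ | Valued.v f ≤ (1 : WithZero (Multiplicative ℤ))} := by
    ext f
    rw [Set.mem_preimage, Set.mem_ofPred_eq, Set.mem_ofPred_eq, ← absVal_le_one_iff,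
      absVal_lt_iff_of_mem_Ioc hj]
    by_cases hf : f = 0
    · simp [hf, absVal_zero, zpow_pos (card_real_pos 𝔽)]
    · rw [absVal_mul, absVal_elemT_zpow, absVal_of_ne_zero hf,
        ← zpow_add₀ (card_real_pos 𝔽).ne', zpow_lt_zpow_iff_right₀ (one_lt_card_real 𝔽),
        zpow_le_one_iff_right₀ (one_lt_card_real 𝔽)]
      omega
  rw [hset]
  exact (isOpen_integers 𝔽).preimage (continuous_const.mul continuous_id)

theorem finite_absVal_incl_le (B : ℝ) : {p : 𝔽[X] | absVal (incl p) ≤ B}.Finite := by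
  obtain ⟨n, hn⟩ := pow_unbounded_of_one_lt B (one_lt_card_real 𝔽)
  have : Finite (Polynomial.degreeLT 𝔽 n) :=
    Finite.of_equiv _ (Polynomial.degreeLTEquiv 𝔽 n).symm.toEquiv
  refine Set.Finite.subset (Set.toFinite (Polynomial.degreeLT 𝔽 n : Set 𝔽[X])) fun p hp => ?_
  by_cases h0 : p = 0
  · simp [h0]
  have h1 : (Nat.card 𝔽 : ℝ) ^ p.natDegree < (Nat.card 𝔽 : ℝ) ^ n := by
    rw [← absVal_incl h0]
    exact lt_of_le_of_lt hp hn
  rw [pow_lt_pow_iff_right₀ (one_lt_card_real 𝔽)] at h1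
  rw [SetLike.mem_coe, Polynomial.mem_degreeLT, Polynomial.degree_eq_natDegree h0]
  exact_mod_cast h1

end AbsVal

section SupNorm

variable {𝔽 ι : Type*} [Field 𝔽]

theorem supNorm_nonneg (x : ι → 𝔽⸨X⸩) : 0 ≤ supNorm x :=
  Real.iSup_nonneg fun _ => absVal_nonneg _

theorem absVal_le_supNorm [Finite ι] (x : ι → 𝔽⸨X⸩) (i : ι) : absVal (x i) ≤ supNorm x :=
  le_ciSup (f := fun i => absVal (x i)) (Set.finite_range _).bddAbove i

theorem supNorm_le {x : ι → 𝔽⸨X⸩} {B : ℝ} (hB : 0 ≤ B) (h : ∀ i, absVal (x i) ≤ B) :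
    supNorm x ≤ B :=
  Real.iSup_le h hB

theorem exists_absVal_eq_supNorm [Finite ι] [Nonempty ι] (x : ι → 𝔽⸨X⸩) :
    ∃ i, absVal (x i) = supNorm x :=
  exists_eq_ciSup_of_finite

theorem supNorm_lt_iff [Finite ι] [Nonempty ι] {x : ι → 𝔽⸨X⸩} {B : ℝ} :
    supNorm x < B ↔ ∀ i, absVal (x i) < B := by
  refine ⟨fun h i => (absVal_le_supNorm x i).trans_lt h, fun h => ?_⟩
  obtain ⟨i, hi⟩ := exists_absVal_eq_supNorm x
  exact hi ▸ h i

variable [Finite 𝔽]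

theorem supNorm_eq_zero_iff [Finite ι] {x : ι → 𝔽⸨X⸩} : supNorm x = 0 ↔ x = 0 := by
  constructor
  · intro h
    ext1 i
    exact absVal_eq_zero_iff.mp
      (le_antisymm (h ▸ absVal_le_supNorm x i) (absVal_nonneg _))
  · rintro rfl
    simp [supNorm, absVal_zero]

theorem supNorm_add_le [Finite ι] (x y : ι → 𝔽⸨X⸩) :
    supNorm (x + y) ≤ max (supNorm x) (supNorm y) :=
  supNorm_le (le_max_of_le_left (supNorm_nonneg x)) fun i =>
    (absVal_add_le _ _).trans (max_le_max (absVal_le_supNorm x i) (absVal_le_supNorm y i))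

theorem supNorm_sub_le [Finite ι] (x y : ι → 𝔽⸨X⸩) :
    supNorm (x - y) ≤ max (supNorm x) (supNorm y) :=
  supNorm_le (le_max_of_le_left (supNorm_nonneg x)) fun i =>
    (absVal_sub_le _ _).trans (max_le_max (absVal_le_supNorm x i) (absVal_le_supNorm y i))

theorem absVal_dotProduct_le [Fintype ι] (x y : ι → 𝔽⸨X⸩) :
    absVal (x ⬝ᵥ y) ≤ supNorm x * supNorm y := by
  refine absVal_sum_le _ _ (mul_nonneg (supNorm_nonneg x) (supNorm_nonneg y)) fun i _ => ?_
  rw [absVal_mul]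
  exact mul_le_mul (absVal_le_supNorm x i) (absVal_le_supNorm y i) (absVal_nonneg _)
    (supNorm_nonneg x)

theorem exists_supNorm_inclVec_eq [Finite ι] {v : ι → 𝔽[X]} (hv : v ≠ 0) :
    ∃ k : ℕ, supNorm (inclVec v) = (Nat.card 𝔽 : ℝ) ^ k := by
  obtain ⟨i₀, hi₀⟩ := Function.ne_iff.mp hv
  have : Nonempty ι := ⟨i₀⟩
  obtain ⟨i, hi⟩ := exists_absVal_eq_supNorm (inclVec v)
  refine ⟨(v i).natDegree, ?_⟩
  rw [← hi]
  refine absVal_incl fun h => ?_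
  have h1 := absVal_le_supNorm (inclVec v) i₀
  rw [← hi, inclVec, inclVec, h, map_zero, absVal_zero] at h1
  exact not_lt.mpr h1 (absVal_pos (incl_ne_zero hi₀))

theorem one_le_supNorm_inclVec [Finite ι] {v : ι → 𝔽[X]} (hv : v ≠ 0) :
    1 ≤ supNorm (inclVec v) := by
  obtain ⟨k, hk⟩ := exists_supNorm_inclVec_eq hv
  rw [hk]
  exact one_le_pow₀ (one_lt_card_real 𝔽).le

end SupNorm

/-! ### Measure of strips around affine hyperplanes -/

section Strips

variable {𝔽 ι : Type*} [Field 𝔽] [Finite 𝔽] [Fintype ι]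

instance isAddHaarMeasure_haar : (haar 𝔽 ι).IsAddHaarMeasure := by
  unfold haar
  infer_instance

theorem isOpen_openBall [Nonempty ι] (c : ι → 𝔽⸨X⸩) (r : ℝ) : IsOpen (openBall c r) := by
  have : openBall c r = ⋂ i, (fun x : ι → 𝔽⸨X⸩ => x i - c i) ⁻¹' {f | absVal f < r} := by
    ext x
    simp [openBall, supNorm_lt_iff]
  rw [this]
  exact isOpen_iInter_of_finite fun i =>
    (isOpen_absVal_lt r).preimage ((continuous_apply i).sub continuous_const)

theorem haar_openBall_ne_top (c : ι → 𝔽⸨X⸩) (r : ℝ) : haar 𝔽 ι (openBall c r) ≠ ⊤ := by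
  obtain ⟨k, hk⟩ := pow_unbounded_of_one_lt r (one_lt_card_real 𝔽)
  have hcpt : IsCompact (Set.univ.pi fun i => (fun f => c i + elemT 𝔽 ^ (k : ℤ) * f) ''
      {f : 𝔽⸨X⸩ | Valued.v f ≤ (1 : WithZero (Multiplicative ℤ))}) :=
    isCompact_univ_pi fun i => (isCompact_integers 𝔽).image
      (continuous_const.add (continuous_const.mul continuous_id))
  refine ((measure_mono fun x hx => ?_).trans_lt hcpt.measure_lt_top).ne
  intro i _
  have hpos := zpow_pos (card_real_pos 𝔽) (k : ℤ)
  have hT : elemT 𝔽 ^ (k : ℤ) ≠ 0 := by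
    intro h
    rw [← absVal_elemT_zpow, h, absVal_zero] at hpos
    exact hpos.false
  refine ⟨(x i - c i) / elemT 𝔽 ^ (k : ℤ), ?_, by field_simp; ring⟩
  rw [Set.mem_ofPred_eq, ← absVal_le_one_iff, absVal_div, absVal_elemT_zpow,
    div_le_one hpos, zpow_natCast]
  exact ((absVal_le_supNorm (x - c) i).trans hx.le).trans hk.le

/-- Translating the strip along a coordinate in which `g` is largest gives `q ^ (M - k)` pairwise
disjoint copies inside the ball, whence the bound. The points of `P` being `q ^ M`-separated makes
strips around different points of `P` stay disjoint. -/
theorem haar_strip_le_zpow [Nonempty ι] (c : ι → 𝔽⸨X⸩) (r : ℝ) (g : ι → 𝔽⸨X⸩) (P : Set 𝔽⸨X⸩)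
    {k M : ℤ} (hkM : k ≤ M) (hM : (Nat.card 𝔽 : ℝ) ^ M ≤ r * supNorm g)
    (hP : ∀ p ∈ P, ∀ p' ∈ P, absVal (p - p') < (Nat.card 𝔽 : ℝ) ^ M → p = p') :
    haar 𝔽 ι {x | x ∈ openBall c r ∧ ∃ p ∈ P, absVal (p + x ⬝ᵥ g) < (Nat.card 𝔽 : ℝ) ^ k} ≤
      ENNReal.ofReal ((Nat.card 𝔽 : ℝ) ^ (k - M)) * haar 𝔽 ι (openBall c r) := by
  classical
  have hq := card_real_pos 𝔽
  have hq1 := one_lt_card_real 𝔽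
  set q : ℝ := (Nat.card 𝔽 : ℝ) with hqdef
  set E := {x | x ∈ openBall c r ∧ ∃ p ∈ P, absVal (p + x ⬝ᵥ g) < q ^ k} with hE
  have hEopen : IsOpen E := by
    have : E = openBall c r ∩ ⋃ p ∈ P, (fun x => p + x ⬝ᵥ g) ⁻¹' {f | absVal f < q ^ k} := by
      ext x
      simp [hE]
    rw [this]
    refine (isOpen_openBall c r).inter (isOpen_biUnion fun p _ => ?_)
    refine (isOpen_absVal_lt _).preimage ?_
    exact continuous_const.add (continuous_finsetSum _ fun i _ =>
      (continuous_apply i).mul continuous_const)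
  obtain ⟨i, hi⟩ := exists_absVal_eq_supNorm g
  have hgpos : 0 < absVal (g i) := by
    rw [hi]
    refine (supNorm_nonneg g).lt_of_ne fun h => ?_
    rw [← h, mul_zero] at hM
    exact not_lt.mpr hM (zpow_pos hq M)
  have hg0 : g i ≠ 0 := fun h => by rw [h, absVal_zero] at hgpos; exact hgpos.false
  obtain ⟨N, hN⟩ : ∃ N : ℕ, M - k = N := ⟨(M - k).toNat, by omega⟩
  have : Finite (Polynomial.degreeLT 𝔽 N) :=
    Finite.of_equiv _ (Polynomial.degreeLTEquiv 𝔽 N).symm.toEquiv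
  have := Fintype.ofFinite (Polynomial.degreeLT 𝔽 N)
  have hcard : (Fintype.card (Polynomial.degreeLT 𝔽 N) : ℝ) = q ^ (M - k) := by
    rw [← Nat.card_eq_fintype_card, Nat.card_congr (Polynomial.degreeLTEquiv 𝔽 N).toEquiv,
      Nat.card_fun, Nat.card_eq_fintype_card (α := Fin N), Fintype.card_fin, hN, zpow_natCast,
      Nat.cast_pow]
  -- the values by which the affine form is shifted
  set z : 𝔽[X] → 𝔽⸨X⸩ := fun p => elemT 𝔽 ^ k * incl p with hz
  have hzlt : ∀ p ∈ Polynomial.degreeLT 𝔽 N, absVal (z p) < q ^ M := by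
    intro p hp
    by_cases h0 : p = 0
    · simp [hz, h0, absVal_zero, zpow_pos hq]
    rw [Polynomial.mem_degreeLT, Polynomial.degree_eq_natDegree h0] at hp
    have hp' : p.natDegree < N := by exact_mod_cast hp
    rw [hz, absVal_mul, absVal_elemT_zpow, absVal_incl h0, ← zpow_natCast, ← zpow_add₀ hq.ne',
      zpow_lt_zpow_iff_right₀ hq1]
    omega
  have hzsub (p p' : 𝔽[X]) : z p - z p' = z (p - p') := by simp [hz, mul_sub]
  set y : Polynomial.degreeLT 𝔽 N → ι → 𝔽⸨X⸩ := fun p => Pi.single i (z p / g i) with hy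
  have hdot (x : ι → 𝔽⸨X⸩) (p : Polynomial.degreeLT 𝔽 N) :
      (x + y p) ⬝ᵥ g = x ⬝ᵥ g + z p := by
    rw [add_dotProduct, hy, single_dotProduct, div_mul_cancel₀ _ hg0]
  set A : Polynomial.degreeLT 𝔽 N → Set (ι → 𝔽⸨X⸩) := fun p => (fun x => x + y p) ⁻¹' E with hA
  have hdisj : Pairwise (Function.onFun Disjoint A) := by
    intro p p' hpp'
    refine Set.disjoint_left.mpr fun x hx hx' => hpp' ?_
    obtain ⟨-, s, hs, hxs⟩ := hx
    obtain ⟨-, s', hs', hxs'⟩ := hx'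
    rw [hdot] at hxs hxs'
    have hdiff : absVal ((s - s') + z ((p : 𝔽[X]) - p')) < q ^ k := by
      rw [← hzsub]
      have : s - s' + (z p - z p') = (s + (x ⬝ᵥ g + z p)) - (s' + (x ⬝ᵥ g + z p')) := by ring
      rw [this]
      exact (absVal_sub_le _ _).trans_lt (max_lt hxs hxs')
    have hss : s = s' := by
      refine hP s hs s' hs' ?_
      have : s - s' = (s - s' + z ((p : 𝔽[X]) - p')) - z ((p : 𝔽[X]) - p') := by ring
      rw [this]
      exact (absVal_sub_le _ _).trans_lt (max_lt
        (hdiff.trans_le (zpow_le_zpow_right₀ hq1.le hkM)) (hzlt _ (sub_mem p.2 p'.2)))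
    rw [hss, sub_self, zero_add, hz, absVal_mul, absVal_elemT_zpow] at hdiff
    have := eq_zero_of_absVal_incl_lt_one
      (lt_of_mul_lt_mul_left (hdiff.trans_eq (mul_one _).symm) (zpow_pos hq k).le)
    exact Subtype.ext (sub_eq_zero.mp this)
  have hsub : (⋃ p, A p) ⊆ openBall c r := by
    refine Set.iUnion_subset fun p x hx => ?_
    have hyr : supNorm (y p) < r := by
      refine supNorm_lt_iff.mpr fun j => ?_
      have hr : absVal (z p / g i) < r := by
        rw [absVal_div, div_lt_iff₀ hgpos, hi]
        exact (hzlt _ p.2).trans_le hM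
      by_cases hj : j = i
      · subst hj
        simpa [hy] using hr
      · simpa [hy, hj, absVal_zero] using (absVal_nonneg _).trans_lt hr
    have : x - c = (x + y p - c) - y p := by abel
    rw [openBall, Set.mem_ofPred_eq, this]
    exact (supNorm_sub_le _ _).trans_lt (max_lt hx.1 hyr)
  have hAmeas (p) : MeasurableSet (A p) :=
    (hEopen.preimage (continuous_id.add continuous_const)).measurableSet
  have hsum : ENNReal.ofReal (q ^ (M - k)) * haar 𝔽 ι E ≤ haar 𝔽 ι (openBall c r) := by
    calc ENNReal.ofReal (q ^ (M - k)) * haar 𝔽 ι E = ∑' p, haar 𝔽 ι (A p) := by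
          simp only [hA, measure_preimage_add_right]
          rw [tsum_fintype, Finset.sum_const, Finset.card_univ, nsmul_eq_mul, ← hcard,
            ENNReal.ofReal_natCast]
      _ ≤ haar 𝔽 ι (⋃ p, A p) := tsum_meas_le_meas_iUnion_of_disjoint _ hAmeas hdisj
      _ ≤ _ := measure_mono hsub
  calc haar 𝔽 ι E
      = ENNReal.ofReal (q ^ (k - M)) * (ENNReal.ofReal (q ^ (M - k)) * haar 𝔽 ι E) := by
        rw [← mul_assoc, ← ENNReal.ofReal_mul (zpow_pos hq _).le, ← zpow_add₀ hq.ne']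
        simp
    _ ≤ _ := by gcongr

/-- The bound of `haar_strip_le_zpow` for strips of arbitrary width `ε`, at the cost of a factor
`q` for rounding `ε` up to a power of `q`. -/
theorem haar_strip_le [Nonempty ι] (c : ι → 𝔽⸨X⸩) (r : ℝ) (g : ι → 𝔽⸨X⸩) (P : Set 𝔽⸨X⸩)
    {M : ℤ} (hM : (Nat.card 𝔽 : ℝ) ^ M ≤ r * supNorm g)
    (hP : ∀ p ∈ P, ∀ p' ∈ P, absVal (p - p') < (Nat.card 𝔽 : ℝ) ^ M → p = p')
    {ε : ℝ} (hε : 0 < ε) :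
    haar 𝔽 ι {x | x ∈ openBall c r ∧ ∃ p ∈ P, absVal (p + x ⬝ᵥ g) < ε} ≤
      ENNReal.ofReal (Nat.card 𝔽 * ε / (Nat.card 𝔽 : ℝ) ^ M) * haar 𝔽 ι (openBall c r) := by
  have hq := card_real_pos 𝔽
  have hq1 := one_lt_card_real 𝔽
  obtain ⟨j, hj⟩ := exists_mem_Ioc_zpow hε hq1
  -- the absolute value takes only powers of `q`, so `< ε` means `< q ^ (j + 1)`
  have hle : (Nat.card 𝔽 : ℝ) ^ (j + 1 - M) ≤ Nat.card 𝔽 * ε / (Nat.card 𝔽 : ℝ) ^ M := by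
    rw [zpow_sub₀ hq.ne', zpow_add_one₀ hq.ne', mul_comm]
    gcongr
    exact hj.1.le
  rcases le_total (j + 1) M with h | h
  · simp only [absVal_lt_iff_of_mem_Ioc hj]
    exact (haar_strip_le_zpow c r g P h hM hP).trans (by gcongr)
  · refine (measure_mono fun x hx => hx.1).trans (le_mul_of_one_le_left' ?_)
    rw [ENNReal.one_le_ofReal]
    exact (one_le_zpow₀ hq1.le (by omega)).trans hle

/-- A form with large gradient is equidistributed modulo `Λ` on the ball. -/
theorem haar_near_incl_le [Nonempty ι] (c : ι → 𝔽⸨X⸩) {r : ℝ} (b : 𝔽⸨X⸩) {g : ι → 𝔽⸨X⸩}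
    (hg : 1 ≤ r * supNorm g) {ε : ℝ} (hε : 0 < ε) :
    haar 𝔽 ι {x | x ∈ openBall c r ∧ ∃ p : 𝔽[X], absVal (b + incl p + x ⬝ᵥ g) < ε} ≤
      ENNReal.ofReal (Nat.card 𝔽 * ε) * haar 𝔽 ι (openBall c r) := by
  have h := haar_strip_le c r g (Set.range fun p : 𝔽[X] => b + incl p) (M := 0)
    (by simpa using hg) (by
      rintro _ ⟨p, rfl⟩ _ ⟨p', rfl⟩ h
      rw [add_sub_add_left_eq_sub, ← map_sub, zpow_zero] at h
      rw [sub_eq_zero.mp (eq_zero_of_absVal_incl_lt_one h)]) hε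
  simpa using h

theorem haar_near_zero_le [Nonempty ι] (c : ι → 𝔽⸨X⸩) {r : ℝ} (b : 𝔽⸨X⸩) {g : ι → 𝔽⸨X⸩}
    (hg : 0 < r * supNorm g) {ε : ℝ} (hε : 0 < ε) :
    haar 𝔽 ι {x | x ∈ openBall c r ∧ absVal (b + x ⬝ᵥ g) < ε} ≤
      ENNReal.ofReal ((Nat.card 𝔽 : ℝ) ^ 2 * ε / (r * supNorm g)) *
        haar 𝔽 ι (openBall c r) := by
  have hq := card_real_pos 𝔽
  obtain ⟨M, hM⟩ := exists_mem_Ico_zpow hg (one_lt_card_real 𝔽)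
  have h := haar_strip_le c r g {b} hM.1 (by rintro p rfl p' rfl _; rfl) hε
  simp only [Set.mem_singleton_iff, exists_eq_left] at h
  refine h.trans (mul_le_mul' (ENNReal.ofReal_le_ofReal ?_) le_rfl)
  have h2 := hM.2.le
  rw [zpow_add_one₀ hq.ne'] at h2
  rw [div_le_div_iff₀ (zpow_pos hq M) hg]
  have := mul_le_mul_of_nonneg_left h2 (mul_pos hq hε).le
  nlinarith

end Strips

/-! ### Counting good simultaneous approximations -/

section ErrorVectors

variable {𝔽 ι : Type*} [Field 𝔽]

/-- The vector `(p_i + α_i u)_i` attached to `w = (p, u)`, measuring how well `-p / u`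
approximates `a`. -/
noncomputable def errVec (a : ι → 𝔽⸨X⸩) (w : (ι → 𝔽[X]) × 𝔽[X]) : ι → 𝔽⸨X⸩ :=
  fun i => incl (w.1 i) + a i * incl w.2

theorem errVec_sub (a : ι → 𝔽⸨X⸩) (w w' : (ι → 𝔽[X]) × 𝔽[X]) :
    errVec a (w - w') = errVec a w - errVec a w' := by
  ext1 i
  simp only [errVec, Prod.fst_sub, Prod.snd_sub, Pi.sub_apply, map_sub]
  ring

theorem errVec_mk_zero (a : ι → 𝔽⸨X⸩) (p : ι → 𝔽[X]) : errVec a (p, 0) = inclVec p := by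
  ext1 i
  simp [errVec, inclVec]

variable [Finite 𝔽] [Finite ι]

/-- For a fixed denominator at most one numerator gives an error smaller than `1`, so the errors
that do not vanish are bounded below. -/
theorem exists_pos_le_supNorm_errVec (a : ι → 𝔽⸨X⸩) {u : 𝔽[X]}
    (hu : ∀ p, supNorm (errVec a (p, u)) ≠ 0) :
    ∃ c : ℝ, 0 < c ∧ ∀ p, c ≤ supNorm (errVec a (p, u)) := by
  by_cases h : ∃ p, supNorm (errVec a (p, u)) < 1
  · obtain ⟨p, hp⟩ := h
    refine ⟨_, (supNorm_nonneg _).lt_of_ne (hu p).symm, fun p' => ?_⟩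
    by_cases hp' : supNorm (errVec a (p', u)) < 1
    · have hlt : supNorm (errVec a ((p, u) - (p', u))) < 1 := by
        rw [errVec_sub]
        exact (supNorm_sub_le _ _).trans_lt (max_lt hp hp')
      rw [Prod.mk_sub_mk, sub_self, errVec_mk_zero] at hlt
      have h0 : p - p' = 0 := by
        by_contra h0
        exact not_lt.mpr (one_le_supNorm_inclVec h0) hlt
      rw [sub_eq_zero.mp h0]
    · exact hp.le.trans (not_lt.mp hp')
  · push Not at h
    exact ⟨1, one_pos, h⟩

end ErrorVectors

section Counting

variable {𝔽 : Type*} [Field 𝔽] [Finite 𝔽] {d : ℕ}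

/-- The Diophantine condition as a bound for all nonzero `w = (p, u)`: the error is at least
`c b ^ (-deg u)`, with `b = q ^ (n - δ)`. Here `deg 0` counts as `0`. -/
theorem DiophantineCondition.exists_lower_bound {a : Fin (d + 1) → 𝔽⸨X⸩}
    (ha : DiophantineCondition a) :
    ∃ b c : ℝ, 1 ≤ b ∧ b < (Nat.card 𝔽 : ℝ) ^ (d + 1) ∧ 0 < c ∧ c ≤ 1 ∧
      ∀ w : (Fin (d + 1) → 𝔽[X]) × 𝔽[X], w ≠ 0 →
        c ≤ supNorm (errVec a w) * b ^ w.2.natDegree := by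
  obtain ⟨δ, hδ, hfin⟩ := ha
  have hq := card_real_pos 𝔽
  have hq1 := one_lt_card_real 𝔽
  set q : ℝ := (Nat.card 𝔽 : ℝ) with hqdef
  set S := {q' : 𝔽[X] | ¬ ∀ p : Fin (d + 1) → 𝔽[X],
      1 / absVal (incl q') ^ (((d + 1 : ℕ) : ℝ) - δ) <
        supNorm (fun i => incl (p i) + a i * incl q')} with hS
  -- a vanishing error at `u` would vanish at all multiples of `u`
  have hne : ∀ u : 𝔽[X], u ≠ 0 → ∀ p, supNorm (errVec a (p, u)) ≠ 0 := by
    intro u hu p h0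
    refine Set.infinite_of_injective_forall_mem (f := fun f : 𝔽[X] => f * u)
      (mul_left_injective₀ hu) (fun f => ?_) hfin
    simp only [hS, Set.mem_ofPred_eq, not_forall, not_lt]
    refine ⟨fun i => f * p i, ?_⟩
    have : (fun i => incl (f * p i) + a i * incl (f * u)) = (0 : Fin (d + 1) → 𝔽⸨X⸩) := by
      ext1 i
      have := congrFun (supNorm_eq_zero_iff.mp h0) i
      simp only [errVec, Pi.zero_apply] at this
      rw [map_mul, map_mul, Pi.zero_apply,
        show incl f * incl (p i) + a i * (incl f * incl u) =
          incl f * (incl (p i) + a i * incl u) by ring, this, mul_zero]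
    rw [this, supNorm_eq_zero_iff.mpr rfl]
    exact one_div_nonneg.mpr (Real.rpow_nonneg (absVal_nonneg _) _)
  have hex : ∃ c : ℝ, 0 < c ∧ c ≤ 1 ∧
      ∀ u ∈ S, u ≠ 0 → ∀ p, c ≤ supNorm (errVec a (p, u)) := by
    have h1 : ∀ᶠ c : ℝ in 𝓝[>] 0, ∀ u ∈ S, u ≠ 0 → ∀ p, c ≤ supNorm (errVec a (p, u)) := by
      rw [Filter.eventually_all_finite hfin]
      intro u _
      by_cases hu : u = 0
      · simp [hu]
      obtain ⟨c, hc, h⟩ := exists_pos_le_supNorm_errVec a (hne u hu)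
      filter_upwards [Ioo_mem_nhdsGT hc] with c' hc' _ p using hc'.2.le.trans (h p)
    obtain ⟨c, hc, hc'⟩ := (h1.and (Ioo_mem_nhdsGT one_pos)).exists
    exact ⟨c, hc'.1, hc'.2.le, hc⟩
  obtain ⟨c, hc, hc1, hcS⟩ := hex
  -- replacing `δ` by `min δ 1` weakens the condition and makes the exponent nonnegative
  set m : ℝ := ((d + 1 : ℕ) : ℝ) - min δ 1 with hm
  have hm0 : 0 ≤ m := by
    have := min_le_right δ 1
    have : (1 : ℝ) ≤ ((d + 1 : ℕ) : ℝ) := by exact_mod_cast Nat.le_add_left 1 d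
    linarith
  have hb1 : 1 ≤ q ^ m := Real.one_le_rpow hq1.le hm0
  refine ⟨q ^ m, c, hb1, ?_, hc, hc1, ?_⟩
  · rw [← Real.rpow_natCast]
    refine Real.rpow_lt_rpow_of_exponent_lt hq1 ?_
    have := lt_min hδ one_pos
    linarith
  rintro ⟨p, u⟩ hw
  have hle : supNorm (errVec a (p, u)) ≤ supNorm (errVec a (p, u)) * (q ^ m) ^ u.natDegree :=
    le_mul_of_one_le_right (supNorm_nonneg _) (one_le_pow₀ hb1)
  by_cases hu : u = 0
  · subst hu
    refine (hc1.trans ?_).trans hle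
    rw [errVec_mk_zero]
    exact one_le_supNorm_inclVec fun h => hw (by rw [h]; rfl)
  by_cases huS : u ∈ S
  · exact (hcS u huS hu p).trans hle
  · have h := not_not.mp huS p
    refine hc1.trans ?_
    rw [absVal_incl hu] at h
    have hpow : (q ^ u.natDegree) ^ (((d + 1 : ℕ) : ℝ) - δ) ≤ (q ^ m) ^ u.natDegree := by
      rw [← Real.rpow_natCast, ← Real.rpow_natCast, ← Real.rpow_mul hq.le, ← Real.rpow_mul hq.le]
      refine Real.rpow_le_rpow_of_exponent_le hq1.le ?_
      rw [mul_comm]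
      refine mul_le_mul_of_nonneg_right ?_ (Nat.cast_nonneg _)
      have := min_le_left δ 1
      linarith
    rw [div_lt_iff₀ (Real.rpow_pos_of_pos (pow_pos hq _) _)] at h
    exact h.le.trans (mul_le_mul_of_nonneg_left hpow (supNorm_nonneg _))

/-- A set is at most `|β|` times as large as a set containing the differences of its elements inside
each fibre of `φ`. -/
theorem encard_le_mul_encard {G β : Type*} [AddGroup G] [Finite β] (S D : Set G) (φ : G → β)
    (h : ∀ x ∈ S, ∀ y ∈ S, φ x = φ y → x - y ∈ D) : S.encard ≤ Nat.card β * D.encard := by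
  classical
  have hex (b : β) : ∃ y, (∃ x ∈ S, φ x = b) → y ∈ S ∧ φ y = b := by
    by_cases hb : ∃ x ∈ S, φ x = b
    · exact hb.imp fun y hy _ => hy
    · exact ⟨0, fun h => absurd h hb⟩
  choose y hy using hex
  have hmaps : Set.MapsTo (fun x => (φ x, x - y (φ x))) S (Set.univ ×ˢ D) := by
    intro x hx
    obtain ⟨h1, h2⟩ := hy (φ x) ⟨x, hx, rfl⟩
    exact ⟨Set.mem_univ _, h x hx _ h1 h2.symm⟩
  refine (Set.encard_le_encard_of_injOn hmaps ?_).trans_eq ?_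
  · intro x _ x' _ hxx'
    have h1 : φ x = φ x' := congrArg Prod.fst hxx'
    have h2 : x - y (φ x) = x' - y (φ x') := congrArg Prod.snd hxx'
    rw [h1] at h2
    exact sub_left_injective h2
  · rw [Set.encard_prod, Set.encard_univ, ENat.card_eq_coe_natCard]

theorem finite_supNorm_inclVec_le (B : ℝ) :
    {w : (Fin (d + 1) → 𝔽[X]) × 𝔽[X] | supNorm (inclVec w.1) ≤ B ∧ w.2 = 0}.Finite := by
  refine Set.Finite.subset ((Set.Finite.pi' fun _ : Fin (d + 1) =>
    finite_absVal_incl_le (𝔽 := 𝔽) B).prod (Set.finite_singleton (0 : 𝔽[X]))) ?_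
  rintro ⟨p, u⟩ ⟨hp, hu⟩
  exact ⟨fun i => (absVal_le_supNorm (inclVec p) i).trans hp, hu⟩

/-- Fix the `i + 1` top coefficients of `u`. The difference of two pairs `(p, u)`, `(p', u')`
sharing them has denominator of degree `< j` and error `< c b ^ (-j)`, so it vanishes by the lower
bound; if `j = 0` it is one of the finitely many integral vectors of norm at most `B`. -/
theorem encard_errVec_le (a : Fin (d + 1) → 𝔽⸨X⸩) {b c B : ℝ} (hb : 1 ≤ b)
    (hB : 0 ≤ B)
    (hlow : ∀ w : (Fin (d + 1) → 𝔽[X]) × 𝔽[X], w ≠ 0 →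
      c ≤ supNorm (errVec a w) * b ^ w.2.natDegree) (i j : ℕ) :
    {w : (Fin (d + 1) → 𝔽[X]) × 𝔽[X] | supNorm (errVec a w) ≤ B ∧ w.2.natDegree ≤ i + j ∧
      (j = 0 ∨ supNorm (errVec a w) * b ^ j < c)}.encard ≤
    ((Nat.card 𝔽 ^ (i + 1) : ℕ) : ℕ∞) *
      {w : (Fin (d + 1) → 𝔽[X]) × 𝔽[X] | supNorm (inclVec w.1) ≤ B ∧ w.2 = 0}.encard := by
  have hcard : Nat.card (Fin (i + 1) → 𝔽) = Nat.card 𝔽 ^ (i + 1) := by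
    rw [Nat.card_fun, Nat.card_eq_fintype_card (α := Fin (i + 1)), Fintype.card_fin]
  rw [← hcard]
  refine encard_le_mul_encard _ _ (fun w => fun l : Fin (i + 1) => w.2.coeff (j + l)) ?_
  rintro w ⟨hwB, hwdeg, hw⟩ w' ⟨hwB', hwdeg', hw'⟩ hww'
  have hsup := supNorm_sub_le (errVec a w) (errVec a w')
  rw [← errVec_sub] at hsup
  have hcoeff : ∀ l, j ≤ l → (w - w').2.coeff l = 0 := by
    intro l hl
    rw [Prod.snd_sub, Polynomial.coeff_sub]
    by_cases hl' : l ≤ i + j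
    · have := congrFun hww' ⟨l - j, by omega⟩
      simp only [Nat.add_sub_cancel' hl] at this
      rw [this, sub_self]
    · rw [Polynomial.coeff_eq_zero_of_natDegree_lt (by omega),
        Polynomial.coeff_eq_zero_of_natDegree_lt (by omega), sub_self]
  rcases Nat.eq_zero_or_pos j with rfl | hj
  · have hu : (w - w').2 = 0 := by
      ext l
      exact hcoeff l (Nat.zero_le _)
    refine ⟨?_, hu⟩
    rw [← errVec_mk_zero a, ← hu]
    exact hsup.trans (max_le hwB hwB')
  · have h0 : w - w' = 0 := by
      by_contra h0
      have hdeg : (w - w').2.natDegree ≤ j :=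
        Polynomial.natDegree_le_iff_coeff_eq_zero.mpr fun l hl => hcoeff l hl.le
      have hlt : supNorm (errVec a (w - w')) * b ^ j < c := by
        refine (mul_le_mul_of_nonneg_right hsup (by positivity)).trans_lt ?_
        rw [max_mul_of_nonneg _ _ (by positivity)]
        exact max_lt (hw.resolve_left hj.ne') (hw'.resolve_left hj.ne')
      refine not_le.mpr hlt ((hlow _ h0).trans ?_)
      exact mul_le_mul_of_nonneg_left (pow_le_pow_right₀ hb hdeg) (supNorm_nonneg _)
    rw [h0]
    refine ⟨?_, rfl⟩
    rw [Prod.fst_zero, supNorm_eq_zero_iff.mpr (by ext1; simp [inclVec])]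
    exact hB

/-- Group the pairs `w = (p, u)` by `deg u = i + j`, where `j` is the level at which the error of
`w` is about `c b ^ (-j)`: by `encard_errVec_le` the sum is dominated by a product of two convergent
geometric series, of ratios `q / q ^ (d + 1)` and `b / q ^ (d + 1)`. -/
theorem tsum_errVec_ne_top (hd : 1 ≤ d) (a : Fin (d + 1) → 𝔽⸨X⸩) {b c B : ℝ} (hb : 1 ≤ b)
    (hbq : b < (Nat.card 𝔽 : ℝ) ^ (d + 1)) (hc : 0 < c) (hB : 0 ≤ B)
    (hlow : ∀ w : (Fin (d + 1) → 𝔽[X]) × 𝔽[X], w ≠ 0 →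
      c ≤ supNorm (errVec a w) * b ^ w.2.natDegree) :
    ∑' w : {w : (Fin (d + 1) → 𝔽[X]) × 𝔽[X] // w ≠ 0 ∧ supNorm (errVec a w) ≤ B},
      ENNReal.ofReal (1 / ((Nat.card 𝔽 : ℝ) ^ (w.1.2.natDegree * (d + 1)) *
        supNorm (errVec a w.1))) ≠ ⊤ := by
  have hq := card_real_pos 𝔽
  have hq1 := one_lt_card_real 𝔽
  have hb0 : 0 < b := by linarith
  set q : ℝ := (Nat.card 𝔽 : ℝ) with hqdef
  set D := {w : (Fin (d + 1) → 𝔽[X]) × 𝔽[X] | supNorm (inclVec w.1) ≤ B ∧ w.2 = 0} with hDdef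
  have hD : D.Finite := finite_supNorm_inclVec_le B
  have hlevel : ∀ w : {w : (Fin (d + 1) → 𝔽[X]) × 𝔽[X] // w ≠ 0 ∧ supNorm (errVec a w) ≤ B},
      ∃ ij : ℕ × ℕ, w.1.2.natDegree = ij.1 + ij.2 ∧ c ≤ supNorm (errVec a w.1) * b ^ (ij.2 + 1) ∧
        (ij.2 = 0 ∨ supNorm (errVec a w.1) * b ^ ij.2 < c) := by
    classical
    intro w
    have hex : ∃ j, c ≤ supNorm (errVec a w.1) * b ^ (j + 1) :=
      ⟨w.1.2.natDegree, (hlow w.1 w.2.1).trans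
        (mul_le_mul_of_nonneg_left (pow_le_pow_right₀ hb (Nat.le_succ _)) (supNorm_nonneg _))⟩
    have hle : Nat.find hex ≤ w.1.2.natDegree := Nat.find_min' hex
      ((hlow w.1 w.2.1).trans
        (mul_le_mul_of_nonneg_left (pow_le_pow_right₀ hb (Nat.le_succ _)) (supNorm_nonneg _)))
    refine ⟨(w.1.2.natDegree - Nat.find hex, Nat.find hex), by simp only; omega,
      Nat.find_spec hex, ?_⟩
    by_cases h0 : Nat.find hex = 0
    · exact Or.inl h0
    · have := Nat.find_min hex (Nat.sub_one_lt h0)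
      rw [Nat.sub_add_cancel (Nat.one_le_iff_ne_zero.mpr h0)] at this
      exact Or.inr (not_le.mp this)
  choose lev hdeg hge hlt using hlevel
  set C : ℝ := D.ncard * q * (b / c) with hC
  have hsummable : Summable fun ij : ℕ × ℕ =>
      C * ((q / q ^ (d + 1)) ^ ij.1 * (b / q ^ (d + 1)) ^ ij.2) := by
    have hqd := pow_pos hq (d + 1)
    refine (Summable.mul_of_nonneg
      (summable_geometric_of_lt_one (div_pos hq hqd).le ?_)
      (summable_geometric_of_lt_one (div_pos hb0 hqd).le ((div_lt_one hqd).mpr hbq))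
      (fun i => by positivity) (fun j => by positivity)).mul_left C
    rw [div_lt_one hqd]
    exact lt_self_pow₀ hq1 (by omega)
  rw [← ENNReal.tsum_fiberwise _ lev]
  refine ne_top_of_le_ne_top hsummable.tsum_ofReal_ne_top (ENNReal.tsum_le_tsum ?_)
  rintro ⟨i, j⟩
  have hterm : ∀ w : lev ⁻¹' {(i, j)},
      ENNReal.ofReal (1 / (q ^ (w.1.1.2.natDegree * (d + 1)) * supNorm (errVec a w.1.1))) ≤
        ENNReal.ofReal (b ^ (j + 1) / c / q ^ ((i + j) * (d + 1))) := by
    rintro ⟨w, hw⟩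
    have hw' : lev w = (i, j) := hw
    have h1 := hdeg w
    have h2 := hge w
    rw [hw'] at h1 h2
    simp only at h1 h2 ⊢
    rw [h1]
    have hpos : 0 < supNorm (errVec a w.1) := by
      refine (supNorm_nonneg _).lt_of_ne fun h => ?_
      rw [← h, zero_mul] at h2
      exact not_lt.mpr h2 hc
    apply ENNReal.ofReal_le_ofReal
    rw [div_div, div_le_div_iff₀ (by positivity) (by positivity)]
    have := mul_le_mul_of_nonneg_left h2 (pow_pos hq ((i + j) * (d + 1))).le
    linarith
  have hcount : (lev ⁻¹' {(i, j)}).encard ≤ ((Nat.card 𝔽 ^ (i + 1) : ℕ) : ℕ∞) * D.encard := by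
    refine le_trans ?_ (encard_errVec_le a hb hB hlow i j)
    refine Set.encard_le_encard_of_injOn (f := Subtype.val) ?_ Subtype.val_injective.injOn
    intro w hw
    have hw' : lev w = (i, j) := hw
    have h1 := hdeg w
    have h3 := hlt w
    rw [hw'] at h1 h3
    exact ⟨w.2.2, h1.le, h3⟩
  calc _ ≤ ∑' _ : lev ⁻¹' {(i, j)}, ENNReal.ofReal (b ^ (j + 1) / c / q ^ ((i + j) * (d + 1))) :=
        ENNReal.tsum_le_tsum hterm
    _ = (lev ⁻¹' {(i, j)}).encard * ENNReal.ofReal (b ^ (j + 1) / c / q ^ ((i + j) * (d + 1))) :=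
        ENNReal.tsum_set_const _ _
    _ ≤ ((((Nat.card 𝔽 ^ (i + 1) : ℕ) : ℕ∞) * D.encard : ℕ∞) : ENNReal) *
        ENNReal.ofReal (b ^ (j + 1) / c / q ^ ((i + j) * (d + 1))) := by gcongr
    _ = ENNReal.ofReal (q ^ (i + 1) * D.ncard) *
        ENNReal.ofReal (b ^ (j + 1) / c / q ^ ((i + j) * (d + 1))) := by
        rw [← hD.cast_ncard_eq, ENNReal.ofReal_mul (by positivity), ENNReal.ofReal_natCast,
          ENNReal.ofReal_pow hq.le, hqdef, ENNReal.ofReal_natCast]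
        simp
    _ = ENNReal.ofReal (C * ((q / q ^ (d + 1)) ^ i * (b / q ^ (d + 1)) ^ j)) := by
        rw [← ENNReal.ofReal_mul (by positivity)]
        congr 1
        rw [hC, div_pow, div_pow, ← pow_mul, ← pow_mul, add_mul, pow_add q (i * (d + 1)),
          pow_succ q i, pow_succ b j, mul_comm (d + 1) i, mul_comm (d + 1) j]
        field_simp

end Counting

/-! ### Affine forms on the hyperplane -/

section AffineForms

variable {𝔽 : Type*} [Field 𝔽] {d : ℕ}

/-- The pair `((p, v₁, …, v_d), v_{d+1})`, whose error vector lists the coefficients of the affine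
form `x ↦ (x, x̃ · a) · v + p`. -/
def coeffPair (v : Fin (d + 1) → 𝔽[X]) (p : 𝔽[X]) : (Fin (d + 1) → 𝔽[X]) × 𝔽[X] :=
  (Fin.cons p (Fin.init v), v (Fin.last d))

theorem hyperplanePoint_dotProduct_add (a : Fin (d + 1) → 𝔽⸨X⸩) (x : Fin d → 𝔽⸨X⸩)
    (v : Fin (d + 1) → 𝔽[X]) (p : 𝔽[X]) :
    hyperplanePoint a x ⬝ᵥ inclVec v + incl p =
      errVec a (coeffPair v p) 0 + x ⬝ᵥ Fin.tail (errVec a (coeffPair v p)) := by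
  have h1 : tilde x ⬝ᵥ a = a 0 + ∑ i, x i * a i.succ := by
    simp [tilde, dotProduct, Fin.sum_univ_succ]
  have h2 : hyperplanePoint a x ⬝ᵥ inclVec v =
      ∑ i : Fin d, x i * incl (v i.castSucc) + (tilde x ⬝ᵥ a) * incl (v (Fin.last d)) := by
    simp [hyperplanePoint, dotProduct, Fin.sum_univ_castSucc, inclVec]
  have h3 : x ⬝ᵥ Fin.tail (errVec a (coeffPair v p)) =
      ∑ i : Fin d, x i * incl (v i.castSucc) +
        (∑ i, x i * a i.succ) * incl (v (Fin.last d)) := by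
    simp only [dotProduct, Fin.tail, errVec, coeffPair, Fin.cons_succ, Fin.init, Finset.sum_mul]
    rw [← Finset.sum_add_distrib]
    exact Finset.sum_congr rfl fun i _ => by ring
  rw [h2, h1, h3]
  simp only [errVec, coeffPair, Fin.cons_zero]
  ring

theorem coeffPair_ne_zero {v : Fin (d + 1) → 𝔽[X]} (hv : v ≠ 0) (p : 𝔽[X]) :
    coeffPair v p ≠ 0 := by
  intro h
  refine hv (funext fun i => ?_)
  refine Fin.lastCases (congrArg Prod.snd h) (fun i => ?_) i
  have := congrFun (congrArg Prod.fst h) i.succ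
  simpa [coeffPair, Fin.init] using this

theorem tail_errVec_coeffPair (a : Fin (d + 1) → 𝔽⸨X⸩) (v : Fin (d + 1) → 𝔽[X]) (p p' : 𝔽[X]) :
    Fin.tail (errVec a (coeffPair v p)) = Fin.tail (errVec a (coeffPair v p')) := by
  ext1 i
  simp [Fin.tail, errVec, coeffPair]

theorem errVec_coeffPair_zero (a : Fin (d + 1) → 𝔽⸨X⸩) (v : Fin (d + 1) → 𝔽[X]) (p : 𝔽[X]) :
    errVec a (coeffPair v p) 0 = a 0 * incl (v (Fin.last d)) + incl p := by
  simp [errVec, coeffPair, add_comm]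

theorem supNorm_eq_max_tail (e : Fin (d + 1) → 𝔽⸨X⸩) :
    supNorm e = max (absVal (e 0)) (supNorm (Fin.tail e)) := by
  apply le_antisymm
  · refine supNorm_le (le_max_of_le_left (absVal_nonneg _)) fun i => ?_
    refine Fin.cases (le_max_left _ _) (fun i => ?_) i
    exact (absVal_le_supNorm (Fin.tail e) i).trans (le_max_right _ _)
  · exact max_le (absVal_le_supNorm e 0)
      (supNorm_le (supNorm_nonneg e) fun i => absVal_le_supNorm e i.succ)

variable [Finite 𝔽]

instance countable_polynomial : Countable 𝔽[X] := by
  rw [← Cardinal.mk_le_aleph0_iff]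
  exact Polynomial.cardinalMk_le_max.trans (by simp)

theorem supNorm_le_of_mem_openBall {c x : Fin d → 𝔽⸨X⸩} {r : ℝ} (hx : x ∈ openBall c r) :
    supNorm x ≤ max 1 (max (supNorm c) r) := by
  have h := supNorm_add_le (x - c) c
  rw [sub_add_cancel] at h
  refine h.trans (max_le ?_ ?_)
  · exact (le_of_lt hx).trans ((le_max_right _ _).trans (le_max_right _ _))
  · exact (le_max_left _ _).trans (le_max_right _ _)

theorem card_pow_natDegree_le_supNorm {v : Fin (d + 1) → 𝔽[X]} (hv : v ≠ 0) (i : Fin (d + 1)) :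
    (Nat.card 𝔽 : ℝ) ^ (v i).natDegree ≤ supNorm (inclVec v) := by
  by_cases h : v i = 0
  · rw [h, Polynomial.natDegree_zero, pow_zero]
    exact one_le_supNorm_inclVec hv
  · rw [← absVal_incl h]
    exact absVal_le_supNorm (inclVec v) i

/-- Where an affine form with coefficients `errVec a w` is smaller than `κ / q ^ (n deg u)`, its
constant term cannot dominate: otherwise the form would be as large as its coefficients, which
the Diophantine lower bound keeps above `c / q ^ (n deg u)`. So the gradient is comparable to the
whole coefficient vector, and the strip is correspondingly thin. -/
theorem haar_small_le (hd : 1 ≤ d) (a : Fin (d + 1) → 𝔽⸨X⸩) {b c₀ : ℝ} (hb : 1 ≤ b)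
    (hbq : b < (Nat.card 𝔽 : ℝ) ^ (d + 1)) (hc₀ : 0 < c₀)
    (hlow : ∀ w : (Fin (d + 1) → 𝔽[X]) × 𝔽[X], w ≠ 0 →
      c₀ ≤ supNorm (errVec a w) * b ^ w.2.natDegree)
    (c : Fin d → 𝔽⸨X⸩) {r : ℝ} (hr : 0 < r) {κ : ℝ} (hκ : 0 < κ) (hκc : κ ≤ c₀)
    {w : (Fin (d + 1) → 𝔽[X]) × 𝔽[X]} (hw : w ≠ 0) :
    haar 𝔽 (Fin d) {x | x ∈ openBall c r ∧ absVal (errVec a w 0 + x ⬝ᵥ Fin.tail (errVec a w)) <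
        κ / (Nat.card 𝔽 : ℝ) ^ (w.2.natDegree * (d + 1))} ≤
      ENNReal.ofReal (κ * ((Nat.card 𝔽 : ℝ) ^ 2 * max 1 (max (supNorm c) r) / r)) *
        ENNReal.ofReal (1 / ((Nat.card 𝔽 : ℝ) ^ (w.2.natDegree * (d + 1)) *
          supNorm (errVec a w))) * haar 𝔽 (Fin d) (openBall c r) := by
  have : Nonempty (Fin d) := ⟨⟨0, hd⟩⟩
  have hq := card_real_pos 𝔽
  set q : ℝ := (Nat.card 𝔽 : ℝ) with hqdef
  set R := max 1 (max (supNorm c) r) with hR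
  have hR1 : 1 ≤ R := le_max_left _ _
  set e := errVec a w with he
  set Q := q ^ (w.2.natDegree * (d + 1)) with hQ
  have hQ0 : 0 < Q := pow_pos hq _
  have hbQ : b ^ w.2.natDegree ≤ Q := by
    rw [hQ, mul_comm, pow_mul]
    exact pow_le_pow_left₀ (by linarith) hbq.le _
  have hlw : c₀ ≤ supNorm e * Q :=
    (hlow w hw).trans (mul_le_mul_of_nonneg_left hbQ (supNorm_nonneg _))
  have hh : 0 < supNorm e := by
    refine (supNorm_nonneg _).lt_of_ne fun h => ?_
    rw [← h, zero_mul] at hlw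
    exact not_lt.mpr hlw hc₀
  rcases le_or_gt (supNorm e) (R * supNorm (Fin.tail e)) with hle | hlt
  · have hg : 0 < supNorm (Fin.tail e) :=
      pos_of_mul_pos_right (hh.trans_le hle) (by linarith)
    refine (haar_near_zero_le c (e 0) (mul_pos hr hg) (div_pos hκ hQ0)).trans ?_
    refine mul_le_mul' ?_ le_rfl
    rw [← ENNReal.ofReal_mul (by positivity)]
    apply ENNReal.ofReal_le_ofReal
    rw [show q ^ 2 * (κ / Q) / (r * supNorm (Fin.tail e)) =
      κ * q ^ 2 / (Q * r) * (1 / supNorm (Fin.tail e)) by field_simp,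
      show κ * (q ^ 2 * R / r) * (1 / (Q * supNorm e)) =
      κ * q ^ 2 / (Q * r) * (R / supNorm e) by field_simp]
    refine mul_le_mul_of_nonneg_left ?_ (by positivity)
    rw [div_le_div_iff₀ hg hh]
    linarith
  -- the constant term dominates the form on the ball, and the strip is empty
  · convert zero_le (α := ENNReal)
    rw [← measure_empty (μ := haar 𝔽 (Fin d))]
    congr 1
    refine Set.eq_empty_iff_forall_notMem.mpr fun x hx => ?_
    obtain ⟨hxU, hxlt⟩ := hx
    have hxg : absVal (x ⬝ᵥ Fin.tail e) < supNorm e :=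
      ((absVal_dotProduct_le _ _).trans (mul_le_mul_of_nonneg_right
        (supNorm_le_of_mem_openBall hxU) (supNorm_nonneg _))).trans_lt hlt
    have hge : supNorm (Fin.tail e) < supNorm e :=
      (le_mul_of_one_le_left (supNorm_nonneg _) hR1).trans_lt hlt
    have he0 : absVal (e 0) = supNorm e := by
      have := supNorm_eq_max_tail e
      rcases max_choice (absVal (e 0)) (supNorm (Fin.tail e)) with h | h
      · rw [this, h]
      · rw [h] at this
        exact absurd this hge.ne'
    rw [← he0] at hxg
    rw [absVal_add_eq_of_lt hxg, he0, lt_div_iff₀ hQ0] at hxlt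
    exact not_lt.mpr (hκc.trans hlw) hxlt

/-- A point of the ball outside the good set lies in a strip of one of the two kinds. -/
theorem openBall_subset_goodSet_union (a : Fin (d + 1) → 𝔽⸨X⸩) (c : Fin d → 𝔽⸨X⸩) {r : ℝ}
    (hr : 0 < r) {ψ : ℝ → ℝ}
    (hψ : ∀ k : ℕ, ψ ((Nat.card 𝔽 : ℝ) ^ k) ≤ 1 / (Nat.card 𝔽 : ℝ) ^ (k * (d + 1)))
    {κ : ℝ} (hκ : 0 < κ) (hκ1 : κ ≤ 1) :
    openBall c r ⊆ goodSet a (openBall c r) ψ κ ∪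
      ((⋃ v : {v : Fin (d + 1) → 𝔽[X] // v ≠ 0},
        {x | 1 ≤ r * supNorm (Fin.tail (errVec a (coeffPair v.1 0))) ∧ x ∈ openBall c r ∧
          ∃ p : 𝔽[X], absVal (a 0 * incl (v.1 (Fin.last d)) + incl p +
            x ⬝ᵥ Fin.tail (errVec a (coeffPair v.1 0))) < κ * psiTerm (d + 1) ψ v}) ∪
      ⋃ w : {w : (Fin (d + 1) → 𝔽[X]) × 𝔽[X] // w ≠ 0 ∧
          supNorm (errVec a w) ≤ max 1 (max 1 (max (supNorm c) r) / r)},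
        {x | x ∈ openBall c r ∧ absVal (errVec a w.1 0 + x ⬝ᵥ Fin.tail (errVec a w.1)) <
          κ / (Nat.card 𝔽 : ℝ) ^ (w.1.2.natDegree * (d + 1))}) := by
  have hq := card_real_pos 𝔽
  have hq1 := one_lt_card_real 𝔽
  intro x hx
  rw [Set.mem_union, or_iff_not_imp_left]
  intro hgood
  simp only [goodSet, Set.mem_ofPred_eq, hx, true_and, not_forall, not_le] at hgood
  obtain ⟨v, hv, p, hp⟩ := hgood
  rw [hyperplanePoint_dotProduct_add] at hp
  rcases le_or_gt 1 (r * supNorm (Fin.tail (errVec a (coeffPair v 0)))) with hlarge | hsmall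
  · left
    refine Set.mem_iUnion.mpr ⟨⟨v, hv⟩, hlarge, hx, p, ?_⟩
    rw [errVec_coeffPair_zero, tail_errVec_coeffPair a v p 0] at hp
    exact hp
  · right
    rw [tail_errVec_coeffPair a v 0 p] at hsmall
    obtain ⟨k, hk⟩ := exists_supNorm_inclVec_eq hv
    have hdeg : (Nat.card 𝔽 : ℝ) ^ (v (Fin.last d)).natDegree ≤ (Nat.card 𝔽 : ℝ) ^ k :=
      hk ▸ card_pow_natDegree_le_supNorm hv (Fin.last d)
    have hψ' : κ * ψ (supNorm (inclVec v)) ≤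
        κ / (Nat.card 𝔽 : ℝ) ^ ((v (Fin.last d)).natDegree * (d + 1)) := by
      rw [div_eq_mul_one_div, hk]
      refine mul_le_mul_of_nonneg_left ((hψ k).trans ?_) hκ.le
      rw [pow_mul, pow_mul]
      gcongr
    have hlt := hp.trans_le hψ'
    set e := errVec a (coeffPair v p) with he
    set R := max 1 (max (supNorm c) r) with hR
    have hR1 : 1 ≤ R := le_max_left _ _
    have hg : supNorm (Fin.tail e) ≤ 1 / r := by
      rw [le_div_iff₀ hr, mul_comm]
      exact hsmall.le
    have hB : supNorm e ≤ max 1 (R / r) := by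
      rw [supNorm_eq_max_tail]
      refine max_le ?_ ((hg.trans (by gcongr)).trans (le_max_right _ _))
      have h1 := absVal_sub_le (e 0 + x ⬝ᵥ Fin.tail e) (x ⬝ᵥ Fin.tail e)
      rw [add_sub_cancel_right] at h1
      refine h1.trans (max_le_max ?_ ?_)
      · refine hlt.le.trans ((div_le_one (by positivity)).mpr (hκ1.trans ?_))
        exact one_le_pow₀ hq1.le
      · refine (absVal_dotProduct_le _ _).trans ?_
        rw [div_eq_mul_one_div]
        exact mul_le_mul (supNorm_le_of_mem_openBall hx) hg (supNorm_nonneg _) (by linarith)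
    exact Set.mem_iUnion.mpr ⟨⟨coeffPair v p, coeffPair_ne_zero hv p, hB⟩, hx, hlt⟩

end AffineForms

end FunctionFieldApprox

open FunctionFieldApprox in
theorem theorem1p2 (𝔽 : Type*) [Field 𝔽] [Finite 𝔽] (d : ℕ) (hd : 1 ≤ d)
    (a : Fin (d + 1) → 𝔽⸨X⸩) (ha : FunctionFieldApprox.DiophantineCondition a)
    (c : Fin d → 𝔽⸨X⸩) (r : ℝ) (hr : 0 < r) :
    ∃ K₀ K₁ : ℝ, 0 < K₀ ∧ 0 < K₁ ∧
      ∀ ψ : ℝ → ℝ, FunctionFieldApprox.IsApproximationFunction 𝔽 ψ →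
        Summable (FunctionFieldApprox.psiTerm (𝔽 := 𝔽) (d + 1) ψ) →
        (∀ k : ℕ, ψ ((Nat.card 𝔽 : ℝ) ^ k) ≤ 1 / (Nat.card 𝔽 : ℝ) ^ (k * (d + 1))) →
        ∀ ξ : ℝ, 0 < ξ → ξ < 1 →
          ∀ κ : ℝ,
            κ < min 1 (min
              (ξ / (2 * (Nat.card 𝔽 : ℝ) * ∑' v, FunctionFieldApprox.psiTerm (𝔽 := 𝔽) (d + 1) ψ v))
              ((ξ / (2 * K₀ * K₁)) ^ ((d + 1) ^ 2 - 1))) →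
            ENNReal.ofReal (1 - ξ) *
                FunctionFieldApprox.haar 𝔽 (Fin d) (FunctionFieldApprox.openBall c r) ≤
              FunctionFieldApprox.haar 𝔽 (Fin d)
                (FunctionFieldApprox.goodSet a (FunctionFieldApprox.openBall c r) ψ κ) := by
  have : Nonempty (Fin d) := ⟨⟨0, hd⟩⟩
  have hq := card_real_pos 𝔽
  obtain ⟨b, c₀, hb, hbq, hc₀, hc₁, hlow⟩ := ha.exists_lower_bound
  set B : ℝ := max 1 (max 1 (max (supNorm c) r) / r) with hB
  have hsum := tsum_errVec_ne_top hd a hb hbq hc₀ (B := B)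
    (zero_le_one.trans (le_max_left _ _)) hlow
  set S := ∑' w : {w : (Fin (d + 1) → 𝔽[X]) × 𝔽[X] // w ≠ 0 ∧ supNorm (errVec a w) ≤ B},
      ENNReal.ofReal (1 / ((Nat.card 𝔽 : ℝ) ^ (w.1.2.natDegree * (d + 1)) *
        supNorm (errVec a w.1))) with hS
  set A : ℝ := (Nat.card 𝔽 : ℝ) ^ 2 * max 1 (max (supNorm c) r) / r with hA
  have hA0 : 0 ≤ A := by positivity
  -- `1 / c₀` makes `κ ≤ c₀`, and `A * S` bounds the small-gradient strips
  set K : ℝ := max (1 / c₀) (A * S.toReal) with hK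
  have hKc : 1 / c₀ ≤ K := le_max_left _ _
  have hK1 : 1 ≤ K := ((one_le_div hc₀).mpr hc₁).trans hKc
  refine ⟨1, K, one_pos, by linarith, fun ψ hψ hψsum hψle ξ hξ hξ1 κ hκ => ?_⟩
  set U := openBall c r with hU
  have hUtop : haar 𝔽 (Fin d) U ≠ ⊤ := haar_openBall_ne_top c r
  have hψpos : ∀ v, 0 < psiTerm (𝔽 := 𝔽) (d + 1) ψ v := by
    intro v
    obtain ⟨k, hk⟩ := exists_supNorm_inclVec_eq v.2
    obtain ⟨s, hs⟩ := hψ.1 k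
    rw [psiTerm, hk, hs]
    exact zpow_pos hq s
  -- a nonpositive `κ` imposes no condition, so the good set is the whole ball
  rcases le_or_gt κ 0 with hκ0 | hκ0
  · have hgood : goodSet a U ψ κ = U := by
      refine Set.Subset.antisymm (fun x hx => hx.1) fun x hx => ⟨hx, fun v hv p => ?_⟩
      exact (mul_nonpos_of_nonpos_of_nonneg hκ0 (hψpos ⟨v, hv⟩).le).trans (absVal_nonneg _)
    rw [hgood]
    refine mul_le_of_le_one_left' ?_
    rw [ENNReal.ofReal_le_one]
    linarith
  obtain ⟨hκ1, hκ2⟩ := lt_min_iff.mp hκ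
  obtain ⟨hκ2, hκ3⟩ := lt_min_iff.mp hκ2
  -- the exponent `n ^ 2 - 1` only weakens the hypothesis, since the base is at most `1`
  have hκK : κ ≤ ξ / (2 * K) := by
    rw [mul_one] at hκ3
    have h1 : ξ / (2 * K) ≤ 1 := (div_le_one (by linarith)).mpr (by linarith)
    refine hκ3.le.trans (pow_le_of_le_one (by positivity) h1 ?_)
    have : 2 ^ 2 ≤ (d + 1) ^ 2 := Nat.pow_le_pow_left (by omega) 2
    omega
  rw [le_div_iff₀ (by linarith)] at hκK
  have hκc : κ ≤ c₀ := by
    have h1 : κ * (1 / c₀) ≤ 1 :=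
      (mul_le_mul_of_nonneg_left hKc hκ0.le).trans (by linarith)
    rwa [mul_one_div, div_le_one hc₀] at h1
  have hκS : κ * A * S.toReal ≤ ξ / 2 := by
    have := mul_le_mul_of_nonneg_left (le_max_right (1 / c₀) (A * S.toReal)) hκ0.le
    rw [← hK] at this
    linarith
  have hκψ : Nat.card 𝔽 * κ * ∑' v, psiTerm (𝔽 := 𝔽) (d + 1) ψ v ≤ ξ / 2 := by
    have hpos : 0 < ∑' v, psiTerm (𝔽 := 𝔽) (d + 1) ψ v :=
      hψsum.tsum_pos (fun v => (hψpos v).le) ⟨fun _ => 1, fun h => one_ne_zero (congrFun h 0)⟩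
        (hψpos _)
    rw [lt_div_iff₀ (by positivity)] at hκ2
    linarith
  have hlarge : ∀ v : {v : Fin (d + 1) → 𝔽[X] // v ≠ 0}, haar 𝔽 (Fin d)
      {x | 1 ≤ r * supNorm (Fin.tail (errVec a (coeffPair v.1 0))) ∧ x ∈ U ∧
          ∃ p : 𝔽[X], absVal (a 0 * incl (v.1 (Fin.last d)) + incl p +
            x ⬝ᵥ Fin.tail (errVec a (coeffPair v.1 0))) < κ * psiTerm (d + 1) ψ v} ≤
      ENNReal.ofReal (Nat.card 𝔽 * κ * psiTerm (d + 1) ψ v) * haar 𝔽 (Fin d) U := by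
    intro v
    by_cases hv : 1 ≤ r * supNorm (Fin.tail (errVec a (coeffPair v.1 0)))
    · simp only [hv, true_and]
      rw [mul_assoc]
      exact haar_near_incl_le c _ hv (mul_pos hκ0 (hψpos v))
    · simp [hv]
  have htotal : haar 𝔽 (Fin d) U ≤ haar 𝔽 (Fin d) (goodSet a U ψ κ) +
      ENNReal.ofReal ξ * haar 𝔽 (Fin d) U := by
    refine (measure_mono (openBall_subset_goodSet_union a c hr hψle hκ0 hκ1.le)).trans ?_
    refine (measure_union_le _ _).trans (add_le_add le_rfl ?_)
    refine (measure_union_le _ _).trans ?_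
    rw [show ξ = ξ / 2 + ξ / 2 by ring, ENNReal.ofReal_add (by linarith) (by linarith), add_mul]
    refine add_le_add ?_ ?_
    · refine (measure_iUnion_le _).trans ((ENNReal.tsum_le_tsum hlarge).trans ?_)
      rw [ENNReal.tsum_mul_right,
        ← ENNReal.ofReal_tsum_of_nonneg
          (fun v => mul_nonneg (by positivity) (hψpos v).le) (hψsum.mul_left _), tsum_mul_left]
      gcongr
    · refine (measure_iUnion_le _).trans ((ENNReal.tsum_le_tsum fun w =>
        haar_small_le hd a hb hbq hc₀ hlow c hr hκ0 hκc w.2.1).trans ?_)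
      rw [ENNReal.tsum_mul_right, ENNReal.tsum_mul_left, ← hS, ← ENNReal.ofReal_toReal hsum,
        ← ENNReal.ofReal_mul (by positivity)]
      gcongr
  have hsplit : ENNReal.ofReal (1 - ξ) * haar 𝔽 (Fin d) U +
      ENNReal.ofReal ξ * haar 𝔽 (Fin d) U = haar 𝔽 (Fin d) U := by
    rw [← add_mul, ← ENNReal.ofReal_add (by linarith) hξ.le, sub_add_cancel, ENNReal.ofReal_one,
      one_mul]
  rw [← hsplit] at htotal
  nth_rewrite 2 [hsplit] at htotal
  exact (ENNReal.add_le_add_iff_right (ENNReal.mul_ne_top ENNReal.ofReal_ne_top hUtop)).mp htotal
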